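/- 1-dimensional Rugby is played on $\mathbb{Z}\times[n]$, $[n]=\{1,\dots,n\}$, with the $\ell_\infty$ distance. The cops choose initial vertices; the robber starts at a vertex whose first coordinate is at least $2n$ less than that of every cop. Then the sides move alternately with perfect information, the cops first: on the cops' turn each cop moves a distance at most $1$, and on the robber's turn he moves a distance at most $2$. The robber wins if no cop is ever on the same vertex as him (after any turn of either side) and for every positive integer $k$ he at some time passes $\{k\}\times[n]$. We say that $m$ cops can prevent the robber from winning if there is a choice of initial positions of $m$ cops, and of such a starting vertex of the robber, from which the robber has no winning strategy. Theorem 3.3. At least $\Omega(n^{0.03})$ cops are needed to prevent the robber from winning; in fact at least $\Omega\big(n^{\ln(3/2)/(2\ln 700)}\big)$ are, the latter exponent being slightly larger than $0.03$. That is, for each of the exponents $\alpha=0.03$ and $\alpha=\frac{\ln(3/2)}{2\ln 700}$ there are $c>0$ and $N$ such that for all $n\ge N$ and all $m$: if $m$ cops can prevent the robber from winning on $\mathbb{Z}\times[n]$, then $m\ge c\,n^{\alpha}$. -/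

import Mathlib

/-! One-dimensional Rugby: a pursuit game on the tunnel `ℤ × [n]`, `[n] = {1, …, n}`, with the
`l_∞` distance.  The cops choose their initial vertices, the robber is placed far to their left,
and then the two sides move alternately, the cops going first, with perfect information.
On their turn each cop moves a distance at most `1`; on his turn the robber moves a distance
at most `2`. -/

namespace Rugby

/-- A position `(x, y)`; the vertices of the tunnel are those with `1 ≤ y ≤ n`. -/
abbrev Pos : Type := ℤ × ℤ

/-- `p` is a vertex of the tunnel `ℤ × {1, …, n}`. -/
def InTunnel (n : ℕ) (p : Pos) : Prop := 1 ≤ p.2 ∧ p.2 ≤ (n : ℤ)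

/-- The `l_∞` distance. -/
def linfDist (p q : Pos) : ℤ := max |p.1 - q.1| |p.2 - q.2|

/-- The positions of a team of `m` cops. Several cops may share a vertex. -/
abbrev Config (m : ℕ) : Type := Fin m → Pos

/-- An opening of the game: the cops stand at vertices `init` of the tunnel and the robber at a
vertex `start` of the tunnel whose first coordinate is at least `2 n` less than that of
every cop. -/
structure IsOpening (n : ℕ) {m : ℕ} (init : Config m) (start : Pos) : Prop where
  cops_in : ∀ i, InTunnel n (init i)
  robber_in : InTunnel n start
  far : ∀ i, start.1 + 2 * (n : ℤ) ≤ (init i).1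

/-- A legal sequence of cop configurations: `c t` is the configuration after `t` cop turns. -/
structure IsCopPlay (n : ℕ) {m : ℕ} (init : Config m) (c : ℕ → Config m) : Prop where
  zero : c 0 = init
  inTunnel : ∀ t i, InTunnel n (c t i)
  step : ∀ t i, linfDist (c t i) (c (t + 1) i) ≤ 1

/-- A legal sequence of robber positions: `r t` is his position after `t` robber turns. -/
structure IsRobberPlay (n : ℕ) (start : Pos) (r : ℕ → Pos) : Prop where
  zero : r 0 = start
  inTunnel : ∀ t, InTunnel n (r t)
  step : ∀ t, linfDist (r t) (r (t + 1)) ≤ 2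

/-- The outcome of an (infinite) play in which the cops' turn `c t → c (t + 1)` is followed by
the robber's turn `r t → r (t + 1)`. The robber wins if no cop is ever on top of him, neither
after a turn of his (or at the start) nor after a turn of the cops, and for every positive `k`
he at some time passes the line `{k} × [n]`. -/
structure RobberWinsPlay {m : ℕ} (c : ℕ → Config m) (r : ℕ → Pos) : Prop where
  uncaught_after_robber : ∀ t i, c t i ≠ r t
  uncaught_after_cops : ∀ t i, c (t + 1) i ≠ r t
  passes : ∀ k : ℤ, 0 < k → ∃ t, k < (r t).1

/-- A (deterministic, perfect-information) strategy of the robber: his next position as a function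
of the list of all cop configurations seen so far, from the initial one to the one just reached.
His own earlier positions are determined by the earlier part of this list. -/
abbrev RobberStrategy (m : ℕ) : Type := List (Config m) → Pos

/-- The robber's positions when he follows `σ` from `start` against the cop moves `c`.  His
`(t + 1)`-st move is made after having seen `c 0, …, c (t + 1)`. -/
def robberPath {m : ℕ} (σ : RobberStrategy m) (start : Pos) (c : ℕ → Config m) : ℕ → Pos
  | 0 => start
  | t + 1 => σ ((List.range (t + 2)).map c)

/-- From the given opening the robber has a strategy that moves legally and wins against every
legal sequence of cop moves. As `robberPath` at time `t` depends only on `c 0, …, c t`, the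
sequences `c` include all those produced by cops who react to the robber's moves. -/
def RobberHasWinningStrategy (n : ℕ) {m : ℕ} (init : Config m) (start : Pos) : Prop :=
  ∃ σ : RobberStrategy m, ∀ c : ℕ → Config m, IsCopPlay n init c →
    IsRobberPlay n start (robberPath σ start c) ∧ RobberWinsPlay c (robberPath σ start c)

/-- `m` cops can prevent the robber from winning on `ℤ × [n]`: there is an opening from which the
robber has no winning strategy. The robber's starting point is any admissible one, which is the
most favourable convention for the cops. -/
def CopsCanPrevent (n m : ℕ) : Prop :=
  ∃ (init : Config m) (start : Pos), IsOpening n init start ∧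
    ¬ RobberHasWinningStrategy n init start

end Rugby

/-! ### One level of the robber's strategy -/

namespace Rugby

/-! The robber always advances 2 in the first coordinate, so every gap shrinks by 1 to 3 per round
and a cop at gap at most `-2` has been passed for good. Only his height is a matter of strategy.

Suppose at most `N` cops matter and more than `cap` of them come within `reach`. He then flees
vertically at speed 2 from the larger of the two groups, above him or not, of the cops in `mid`. He
gains 1 per round on these, so after the delay they can be ignored until they are passed. What
remains is at most half of the near cops plus those that were not near, hence at most `cap` cops
when `2 * N < 3 * (cap + 1)`. During the delay the next level keeps only the cops it already had
(`hold`); all others have just come within reach and are still too far away to matter. These are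
`Inv.card_act` and `join_act`.

So a level cuts the number of dangerous cops by a factor of about 2/3 and passes the rest to a level
with much smaller reach, until none is left. Deeper escapes override shallower ones. This is
affordable: escapes of one level begin with disjoint sets of more than `cap` near cops, so there are
few of them (`card_escaping_le`), and their lengths decay geometrically with depth. The lost rounds
fit into the delay (`two_le_of_flee`), and the total drift fits into the tunnel (`inTunnel`).

With scale ratio `700 ^ 2`, `K` levels beat `capacity K` cops, at least `(3/2)^K - 1`, on width `148
* ratio ^ K`. Taking `K` logarithmic in `n` gives the exponent. -/

/-- The parameters of one level of the robber's strategy: cops whose gap exceeds `reach` are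
disregarded, an escape releases the cops it flees from after `delay` rounds, and the next level
can deal with `cap` cops. -/
structure Scale where
  reach : ℕ
  delay : ℕ
  cap : ℕ

/-- The number of rounds an escape lasts. -/
def Scale.span (S : Scale) : ℕ := S.reach + 2

/-- The state of one level: an escape is going on iff `age < span`, in the direction `dir`, away
from the cops in `flee`; `hold` are the cops the next level had to deal with when it began, and
`act` are the cops the next level has to deal with. -/
structure Level (ι : Type*) where
  age : ℕ
  dir : ℤ
  hold : Finset ι
  flee : Finset ι
  act : Finset ι

section Level

variable {ι : Type*}

/-- The cops of `A` that have not been passed and are within reach. -/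
def Scale.near (S : Scale) (A : Finset ι) (g : ι → ℤ) : Finset ι :=
  {i ∈ A | -2 < g i ∧ g i ≤ S.reach}

/-- The cops within reach that cannot be passed before the delay is over. -/
def Scale.mid (S : Scale) (A : Finset ι) (g : ι → ℤ) : Finset ι :=
  {i ∈ A | (S.delay : ℤ) < g i ∧ g i ≤ S.reach}

/-- The state of a level that is not escaping and sees no cops. -/
def Level.idle (S : Scale) : Level ι := ⟨S.span, 0, ∅, ∅, ∅⟩

theorem Scale.mem_near {S : Scale} {A : Finset ι} {g : ι → ℤ} {i : ι} :
    i ∈ S.near A g ↔ i ∈ A ∧ -2 < g i ∧ g i ≤ S.reach := by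
  simp [Scale.near]

theorem Scale.mem_mid {S : Scale} {A : Finset ι} {g : ι → ℤ} {i : ι} :
    i ∈ S.mid A g ↔ i ∈ A ∧ (S.delay : ℤ) < g i ∧ g i ≤ S.reach := by
  simp [Scale.mid]

variable [DecidableEq ι]

/-- One round of a level which has to deal with the cops in `A`; here `g` are the gaps in the
first coordinate and `u` the heights of the cops relative to the robber. -/
def Level.next (S : Scale) (A : Finset ι) (g u : ι → ℤ) (L : Level ι) : Level ι :=
  if L.age + 1 < S.span then
    ⟨L.age + 1, L.dir, L.hold, L.flee,
      if L.age + 1 < S.delay + 2 then S.near A g ∩ L.hold else S.near A g \ L.flee⟩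
  else if (S.near A g).card ≤ S.cap then
    ⟨S.span, 0, ∅, ∅, S.near A g⟩
  else if ({i ∈ S.mid A g | 0 < u i}).card ≤ ({i ∈ S.mid A g | u i ≤ 0}).card then
    ⟨0, 1, S.near A g ∩ L.act, {i ∈ S.mid A g | u i ≤ 0}, S.near A g ∩ L.act⟩
  else
    ⟨0, -1, S.near A g ∩ L.act, {i ∈ S.mid A g | 0 < u i}, S.near A g ∩ L.act⟩

/-- The history of one level, and the conditions under which it works: there are never more than
`N` cops to deal with, and they are assigned to the level at gaps of at least `G`. -/
structure LevelRun (S : Scale) (N : ℕ) (G : ℤ) (A : ℕ → Finset ι) (g u : ℕ → ι → ℤ)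
    (L : ℕ → Level ι) : Prop where
  init : L 0 = Level.idle S
  next : ∀ t, L (t + 1) = (L t).next S (A (t + 1)) (g (t + 1)) (u (t + 1))
  fall : ∀ t i, g t i - 3 ≤ g (t + 1) i ∧ g (t + 1) i ≤ g t i - 1
  far : ∀ i ∈ A 0, G ≤ g 0 i
  join : ∀ t, ∀ i ∈ A (t + 1), i ∉ A t → G ≤ g (t + 1) i
  card : ∀ t, (A t).card ≤ N
  reach_le : 4 * (S.reach : ℤ) + 7 ≤ G
  delay_le : 3 * S.delay + 10 ≤ S.reach
  cap_lt : 2 * N < 3 * (S.cap + 1)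

/-- What is known about an escape in progress which began at time `s`. -/
structure Escape (S : Scale) (A : Finset ι) (g u : ι → ℤ) (L : Level ι) : Prop where
  card_near : S.cap < (S.near A g).card
  card_hold : L.hold.card ≤ S.cap
  late : ∀ i ∈ S.near A g, i ∉ L.hold → (S.reach : ℤ) - 3 < g i
  flee_subset : L.flee ⊆ S.mid A g
  card_flee : (S.mid A g).card ≤ 2 * L.flee.card
  dir_eq : L.dir = 1 ∨ L.dir = -1
  away : ∀ i ∈ L.flee, 0 ≤ L.dir * (-u i)

namespace LevelRun

open Scale (mem_near mem_mid)

variable {S : Scale} {N : ℕ} {G : ℤ} {A : ℕ → Finset ι} {g u : ℕ → ι → ℤ} {L : ℕ → Level ι}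

theorem gap_add (R : LevelRun S N G A g u L) (s k : ℕ) (i : ι) :
    g s i - 3 * k ≤ g (s + k) i ∧ g (s + k) i ≤ g s i - k := by
  induction k with
  | zero => simp
  | succ k ih =>
    have := R.fall (s + k) i
    rw [← add_assoc]
    push_cast
    omega

theorem gap_le (R : LevelRun S N G A g u L) {s t : ℕ} (h : s ≤ t) (i : ι) :
    g s i - 3 * ((t : ℤ) - s) ≤ g t i ∧ g t i ≤ g s i - ((t : ℤ) - s) := by
  obtain ⟨k, rfl⟩ := Nat.exists_eq_add_of_le h
  have := R.gap_add s k i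
  push_cast
  omega

/-- A cop that is within reach has been assigned to the level for a long time. -/
theorem mem_of_near (R : LevelRun S N G A g u L) {s t : ℕ} (hst : s ≤ t) (ht : t ≤ s + S.span)
    {i : ι} (hi : i ∈ S.near (A t) (g t)) : i ∈ A s := by
  obtain ⟨hiA, -, hig⟩ := mem_near.1 hi
  have hG := R.reach_le
  unfold Scale.span at ht
  -- Go back in time from `t`: a cop joining at gap at least `4 * reach + 7` within the last `reach
  -- + 2` rounds would still have gap at least `reach + 1`.
  have key : ∀ k, k ≤ t - s → i ∈ A (t - k) := by
    intro k
    induction k with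
    | zero => intro _; simpa using hiA
    | succ k ih =>
      intro hk
      by_contra hn
      have h1 := ih (by omega)
      have e : t - k = t - (k + 1) + 1 := by omega
      rw [e] at h1
      have h2 := R.join _ i h1 hn
      rw [← e] at h2
      have h3 := R.gap_le (show t - k ≤ t by omega) i
      omega
  have := key (t - s) le_rfl
  rwa [show t - (t - s) = s by omega] at this

theorem near_of_near (R : LevelRun S N G A g u L) {r s t : ℕ} (hrs : r ≤ s) (hst : s ≤ t)
    (ht : t ≤ s + S.span) {i : ι} (hi : i ∈ S.near (A t) (g t)) (hr : g r i ≤ S.reach) :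
    i ∈ S.near (A s) (g s) := by
  have h1 := R.gap_le hrs i
  have h2 := R.gap_le hst i
  obtain ⟨hiA, hi1, hi2⟩ := mem_near.1 hi
  exact mem_near.2 ⟨R.mem_of_near hst ht hi, by omega, by omega⟩

/-- The state of a level at time `t`, an escape having begun at time `t - age` if it is
escaping. -/
structure Inv (S : Scale) (A : ℕ → Finset ι) (g u : ℕ → ι → ℤ) (L : Level ι) (t : ℕ) : Prop where
  age_le : L.age ≤ S.span
  normal : L.age = S.span → L.act = S.near (A t) (g t) ∧ L.act.card ≤ S.cap
  escape : L.age < S.span → L.age ≤ t ∧ Escape S (A (t - L.age)) (g (t - L.age)) (u (t - L.age)) L ∧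
    L.act = if L.age < S.delay + 2 then S.near (A t) (g t) ∩ L.hold else S.near (A t) (g t) \ L.flee

/-- Only the phase after the delay needs counting. With `near` and `mid` taken at the start of the
escape, at most `near / 2` cops of `mid` are not fled from and at most `N - near` were not near. As
`near ≥ cap + 1`, twice the sum is less than `3 * (cap + 1) - (cap + 1)`. -/
theorem Inv.card_act (R : LevelRun S N G A g u L) {t : ℕ} (I : Inv S A g u (L t) t) :
    (L t).act.card ≤ S.cap := by
  rcases I.age_le.lt_or_eq with h | h
  swap
  · exact (I.normal h).2
  obtain ⟨hle, E, hact⟩ := I.escape h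
  generalize hs : t - (L t).age = s at E
  split_ifs at hact with hd
  · rw [hact]
    exact (Finset.card_le_card Finset.inter_subset_right).trans E.card_hold
  -- A cop near at the start but not in `mid` has by now been passed, since at least `delay + 2`
  -- rounds have gone by.
  have hsub : (L t).act ⊆ ((S.mid (A s) (g s)) \ (L t).flee) ∪ (A s \ S.near (A s) (g s)) := by
    intro i hi
    rw [hact, Finset.mem_sdiff] at hi
    have hiA := R.mem_of_near (s := s) (by omega) (by omega) hi.1
    have h1 := R.gap_le (show s ≤ t by omega) i
    obtain ⟨-, h2, h3⟩ := mem_near.1 hi.1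
    rw [Finset.mem_union, Finset.mem_sdiff, Finset.mem_sdiff, mem_mid, mem_near]
    by_cases hr : g s i ≤ S.reach
    · exact Or.inl ⟨⟨hiA, by omega, hr⟩, hi.2⟩
    · exact Or.inr ⟨hiA, fun hh => hr hh.2.2⟩
  have h1 := Finset.card_le_card hsub
  have h2 := Finset.card_union_le (S.mid (A s) (g s) \ (L t).flee) (A s \ S.near (A s) (g s))
  have h3 := Finset.card_sdiff_add_card_eq_card E.flee_subset
  have h4 := Finset.card_sdiff_add_card_eq_card
    (show S.near (A s) (g s) ⊆ A s from Finset.filter_subset _ _)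
  have h5 := R.card s
  have h6 := R.cap_lt
  have h7 := E.card_near
  have h8 := E.card_flee
  have h9 : (S.mid (A s) (g s)).card ≤ (S.near (A s) (g s)).card := by
    apply Finset.card_le_card
    intro i hi
    rw [mem_mid] at hi
    exact mem_near.2 ⟨hi.1, by omega, hi.2.2⟩
  omega

/-- Between two escapes, and when an escape begins, the cops not yet dealt with by the next
level have just come within reach. -/
theorem Inv.late (R : LevelRun S N G A g u L) {t : ℕ} (I : Inv S A g u (L t) t)
    (hage : ¬ (L t).age + 1 < S.span) {i : ι} (hi : i ∈ S.near (A (t + 1)) (g (t + 1)))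
    (hn : i ∉ (L t).act) : (S.reach : ℤ) - 3 < g (t + 1) i := by
  have hd := R.delay_le
  have hf := R.fall t i
  by_contra hlt
  have hnear : i ∈ S.near (A t) (g t) :=
    R.near_of_near (r := t) le_rfl (by omega) (by unfold Scale.span; omega) hi (by omega)
  rcases I.age_le.lt_or_eq with h | h
  · obtain ⟨hle, E, hact⟩ := I.escape h
    unfold Scale.span at h hage
    rw [if_neg (by omega)] at hact
    rw [hact, Finset.mem_sdiff] at hn
    -- Such a cop had gap at most `reach` when the escape began; the `span = reach + 2` rounds bring
    -- it to at most `-2`, so it is no longer near.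
    have hfl : i ∈ (L t).flee := by tauto
    have h1 := (mem_mid.1 (E.flee_subset hfl)).2.2
    have h2 := R.gap_le (show t - (L t).age ≤ t + 1 by omega) i
    have h3 := (mem_near.1 hi).2.1
    omega
  · exact hn ((I.normal h).1 ▸ hnear)

theorem inv (R : LevelRun S N G A g u L) (t : ℕ) : Inv S A g u (L t) t := by
  induction t with
  | zero =>
    rw [R.init]
    refine ⟨le_rfl, fun _ => ⟨?_, by simp [Level.idle]⟩, fun h => absurd h (by simp [Level.idle])⟩
    symm
    simp only [Level.idle]
    rw [Finset.eq_empty_iff_forall_notMem]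
    intro i hi
    have h1 := R.far i (mem_near.1 hi).1
    have h2 := (mem_near.1 hi).2.2
    have := R.reach_le
    omega
  | succ t I =>
    have hnext := R.next t
    unfold Level.next at hnext
    by_cases h1 : (L t).age + 1 < S.span
    · rw [if_pos h1] at hnext
      obtain ⟨hle, E, hact⟩ := I.escape (by omega)
      rw [hnext]
      refine ⟨h1.le, fun h => absurd h h1.ne, fun _ => ⟨by simpa using hle, ?_, rfl⟩⟩
      simp only [Nat.add_sub_add_right]
      exact ⟨E.1, E.2, E.3, E.4, E.5, E.6, E.7⟩
    rw [if_neg h1] at hnext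
    by_cases h2 : (S.near (A (t + 1)) (g (t + 1))).card ≤ S.cap
    · rw [if_pos h2] at hnext
      rw [hnext]
      exact ⟨le_rfl, fun _ => ⟨rfl, h2⟩, fun h => absurd h (lt_irrefl _)⟩
    rw [if_neg h2] at hnext
    split_ifs at hnext with h3
    all_goals
      have hmid := Finset.card_filter_add_card_filter_not (s := S.mid (A (t + 1)) (g (t + 1)))
        (fun i => 0 < u (t + 1) i)
      simp only [not_lt] at hmid
      rw [hnext]
      refine ⟨Nat.zero_le _, fun h => absurd h (by simp [Scale.span]), fun _ => ⟨Nat.zero_le _, ?_, ?_⟩⟩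
      · simp only [Nat.sub_zero]
        refine ⟨by omega,
          (Finset.card_le_card Finset.inter_subset_right).trans (Inv.card_act R I), ?_,
          Finset.filter_subset _ _, by dsimp only; omega, by simp, ?_⟩
        · intro i hi hn
          exact Inv.late R I h1 hi fun hh => hn (Finset.mem_inter.2 ⟨hi, hh⟩)
        · intro i hi
          have := (Finset.mem_filter.1 hi).2
          dsimp only
          omega
      · rw [if_pos (by dsimp only; omega)]
        ext i
        simp

theorem card_act (R : LevelRun S N G A g u L) (t : ℕ) : (L t).act.card ≤ S.cap :=
  (R.inv t).card_act R

theorem act_subset (R : LevelRun S N G A g u L) (t : ℕ) : (L t).act ⊆ S.near (A t) (g t) := by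
  have I := R.inv t
  rcases I.age_le.lt_or_eq with h | h
  · rw [(I.escape h).2.2]
    split_ifs
    · exact Finset.inter_subset_left
    · exact Finset.sdiff_subset
  · rw [(I.normal h).1]

/-- Cops not held back at the start of an escape are still far away when its delay is over. -/
theorem gap_of_not_hold (R : LevelRun S N G A g u L) {s t : ℕ} {M : Level ι}
    (E : Escape S (A s) (g s) (u s) M) (hst : s ≤ t) (ht : t ≤ s + S.span) {i : ι}
    (hi : i ∈ S.near (A t) (g t)) (hn : i ∉ M.hold) :
    (S.reach : ℤ) - 2 - 3 * ((t : ℤ) - s) ≤ g t i := by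
  have h1 := R.gap_le hst i
  by_cases hs : g s i ≤ S.reach
  · have := E.late i (R.near_of_near le_rfl hst ht hi hs) hn
    omega
  · omega

/-- Provides the hypothesis `join` of the next level: new cops are handed down only from afar. The
worst case is the switch from `hold` to the complement of `flee` at age `delay + 2`, where the gap
is still at least `reach - 2 - 3 * (delay + 2)`. -/
theorem join_act (R : LevelRun S N G A g u L) (t : ℕ) (i : ι) (hi : i ∈ (L (t + 1)).act)
    (hn : i ∉ (L t).act) : (S.reach : ℤ) - 3 * S.delay - 8 ≤ g (t + 1) i := by
  have hnear := R.act_subset _ hi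
  have hd := R.delay_le
  have I := R.inv t
  have hf := R.fall t i
  have hspan : S.span = S.reach + 2 := rfl
  by_cases h1 : (L t).age + 1 < S.span
  swap
  · have := I.late R h1 hnear hn
    omega
  obtain ⟨hle, E, hact⟩ := I.escape (by omega)
  have hnext := R.next t
  rw [Level.next, if_pos h1] at hnext
  rw [hnext] at hi
  dsimp only at hi
  by_contra hlt
  have hnt : i ∈ S.near (A t) (g t) :=
    R.near_of_near (r := t) le_rfl (by omega) (by omega) hnear (by omega)
  have hhold : i ∈ (L t).hold → (L t).age < S.delay + 2 → False := by
    intro hh hlt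
    rw [if_pos hlt] at hact
    exact hn (hact ▸ Finset.mem_inter.2 ⟨hnt, hh⟩)
  split_ifs at hi with h2
  · exact hhold (Finset.mem_inter.1 hi).2 (by omega)
  · by_cases h3 : (L t).age < S.delay + 2
    · have := R.gap_of_not_hold E (t := t + 1) (by omega) (by omega) hnear fun hh => hhold hh h3
      omega
    · rw [if_neg h3] at hact
      exact hn (hact ▸ Finset.mem_sdiff.2 ⟨hnt, (Finset.mem_sdiff.1 hi).2⟩)

/-- A cop that is not handed down to the next level is harmless, unless the robber is fleeing
from it. -/
theorem harmless_or_flee (R : LevelRun S N G A g u L) {t : ℕ} {i : ι} (hi : i ∈ A t)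
    (hn : i ∉ (L t).act) :
    2 ≤ g t i ∨ g t i ≤ -2 ∨
      ((L t).age < S.span ∧ S.delay + 2 ≤ (L t).age ∧ i ∈ (L t).flee) := by
  have hd := R.delay_le
  by_cases hnear : i ∈ S.near (A t) (g t)
  swap
  · rw [mem_near] at hnear
    have : ¬ (-2 < g t i ∧ g t i ≤ S.reach) := fun h => hnear ⟨hi, h⟩
    omega
  have I := R.inv t
  rcases I.age_le.lt_or_eq with h | h
  · obtain ⟨hle, E, hact⟩ := I.escape h
    split_ifs at hact with h2
    · left
      have := R.gap_of_not_hold E (t := t) (by omega) (by omega) hnear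
        fun hh => hn (hact ▸ Finset.mem_inter.2 ⟨hnear, hh⟩)
      omega
    · right; right
      refine ⟨h, by omega, ?_⟩
      by_contra hh
      exact hn (hact ▸ Finset.mem_sdiff.2 ⟨hnear, hh⟩)
  · exact absurd ((I.normal h).1 ▸ hnear) hn

/-- During an escape the direction does not change. -/
theorem age_sub (R : LevelRun S N G A g u L) {t : ℕ} (h : (L t).age < S.span) (k : ℕ)
    (hk : k ≤ (L t).age) : (L (t - k)).age = (L t).age - k ∧ (L (t - k)).dir = (L t).dir := by
  induction k with
  | zero => simp
  | succ k ih =>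
    obtain ⟨ih1, ih2⟩ := ih (by omega)
    have hle := ((R.inv t).escape h).1
    have e : t - k = t - (k + 1) + 1 := by omega
    rw [e] at ih1 ih2
    rw [R.next, Level.next] at ih1 ih2
    split_ifs at ih1 ih2 <;> dsimp only at ih1 ih2 <;> omega

/-- Escapes last `span` rounds. -/
theorem age_add (R : LevelRun S N G A g u L) {t : ℕ} (k : ℕ) (h : (L t).age + k < S.span) :
    (L (t + k)).age = (L t).age + k := by
  induction k with
  | zero => simp
  | succ k ih =>
    have := ih (by omega)
    rw [← add_assoc, R.next, Level.next, if_pos (by omega)]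
    dsimp only
    omega

/-- Escapes of one level do not overlap: the age runs from 0 to `span` before it can be reset, so a
second start inside the span would have age 0 and positive age at once. -/
theorem start_add_span_le (R : LevelRun S N G A g u L) {t t' : ℕ} (h : (L t).age < S.span)
    (h' : (L t').age < S.span) (hlt : t - (L t).age < t' - (L t').age) :
    t - (L t).age + S.span ≤ t' - (L t').age := by
  have hle := ((R.inv t).escape h).1
  have hle' := ((R.inv t').escape h').1
  by_contra hc
  obtain ⟨h1, -⟩ := R.age_sub h' (L t').age le_rfl
  obtain ⟨h2, -⟩ := R.age_sub h (L t).age le_rfl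
  have h3 := R.age_add (t := t - (L t).age) (t' - (L t').age - (t - (L t).age)) (by omega)
  rw [show t - (L t).age + (t' - (L t').age - (t - (L t).age)) = t' - (L t').age by omega] at h3
  omega

/-- The number of rounds a level spends escaping within some period of time is bounded in terms
of the number of cops it has to deal with. -/
theorem card_escaping_le (R : LevelRun S N G A g u L) (a b : ℕ) (B : Finset ι)
    (hB : ∀ t ∈ Finset.Ico a b, S.near (A t) (g t) ⊆ B) :
    ({t ∈ Finset.Ico a b | (L t).age < S.span}).card
      ≤ (B.card / (S.cap + 1) + 1) * S.span := by
  classical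
  set T := {t ∈ Finset.Ico a b | (L t).age < S.span} with hT
  have hmem : ∀ t ∈ T, (a ≤ t ∧ t < b) ∧ (L t).age < S.span := fun t ht => by
    simpa [hT] using ht
  set f : ℕ → ℕ := fun t => t - (L t).age with hf
  have hfib : T.card ≤ S.span * (T.image f).card := by
    apply Finset.card_le_mul_card_image
    intro s hs
    have : ({t ∈ T | f t = s}) ⊆ Finset.Ico s (s + S.span) := by
      intro t ht
      obtain ⟨ht', rfl⟩ := Finset.mem_filter.1 ht
      have h1 := (hmem t ht').2
      have h2 := ((R.inv t).escape h1).1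
      simp only [hf, Finset.mem_Ico]
      omega
    simpa using Finset.card_le_card this
  set T₁ := {s ∈ T.image f | a ≤ s} with hT₁
  set T₀ := {s ∈ T.image f | ¬ a ≤ s} with hT₀
  have hsplit : T₁.card + T₀.card = (T.image f).card := Finset.card_filter_add_card_filter_not _
  -- At most one escape can be already under way when the period begins; this is the `+ 1` in the
  -- bound.
  have h0 : T₀.card ≤ 1 := by
    rw [Finset.card_le_one]
    intro x hx y hy
    obtain ⟨hx, hxa⟩ := Finset.mem_filter.1 hx
    obtain ⟨hy, hya⟩ := Finset.mem_filter.1 hy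
    obtain ⟨t, ht, rfl⟩ := Finset.mem_image.1 hx
    obtain ⟨t', ht', rfl⟩ := Finset.mem_image.1 hy
    obtain ⟨⟨h1, -⟩, h2⟩ := hmem t ht
    obtain ⟨⟨h1', -⟩, h2'⟩ := hmem t' ht'
    have h3 := ((R.inv t).escape h2).1
    have h3' := ((R.inv t').escape h2').1
    have h4 := R.start_add_span_le h2 h2'
    have h5 := R.start_add_span_le h2' h2
    simp only [hf] at *
    omega
  -- Starts lie at least `reach + 2` rounds apart, so a cop near at one start has been passed by the
  -- next; the sets of near cops are disjoint.
  have h1 : T₁.card * (S.cap + 1) ≤ B.card := by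
    have hdisj : (T₁ : Set ℕ).PairwiseDisjoint fun s => S.near (A s) (g s) := by
      have aux : ∀ x ∈ T₁, ∀ y ∈ T₁, x < y → Disjoint (S.near (A x) (g x)) (S.near (A y) (g y)) := by
        intro x hx y hy hxy
        obtain ⟨hx, hxa⟩ := Finset.mem_filter.1 hx
        obtain ⟨hy, hya⟩ := Finset.mem_filter.1 hy
        obtain ⟨t, ht, rfl⟩ := Finset.mem_image.1 hx
        obtain ⟨t', ht', rfl⟩ := Finset.mem_image.1 hy
        have h4 := R.start_add_span_le (hmem t ht).2 (hmem t' ht').2 hxy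
        rw [Finset.disjoint_left]
        intro i hi hi'
        have h5 := R.gap_le hxy.le i
        have h6 := (mem_near.1 hi).2.2
        have h7 := (mem_near.1 hi').2.1
        simp only [hf, Scale.span] at *
        omega
      intro x hx y hy hxy
      rcases lt_or_gt_of_ne hxy with h | h
      · exact aux x hx y hy h
      · exact (aux y hy x hx h).symm
    have hsub : T₁.biUnion (fun s => S.near (A s) (g s)) ⊆ B := by
      rw [Finset.biUnion_subset]
      intro s hs
      obtain ⟨hs, hsa⟩ := Finset.mem_filter.1 hs
      obtain ⟨t, ht, rfl⟩ := Finset.mem_image.1 hs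
      have := (hmem t ht).1
      exact hB _ (by simp only [hf, Finset.mem_Ico] at *; omega)
    have h3 := Finset.card_le_card hsub
    rw [Finset.card_biUnion hdisj] at h3
    refine le_trans ?_ h3
    rw [← smul_eq_mul]
    apply Finset.card_nsmul_le_sum
    intro s hs
    obtain ⟨hs, hsa⟩ := Finset.mem_filter.1 hs
    obtain ⟨t, ht, rfl⟩ := Finset.mem_image.1 hs
    exact ((R.inv t).escape (hmem t ht).2).2.1.card_near
  have h2 : T₁.card ≤ B.card / (S.cap + 1) := (Nat.le_div_iff_mul_le (by omega)).2 h1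
  calc T.card ≤ S.span * (T.image f).card := hfib
    _ ≤ S.span * (B.card / (S.cap + 1) + 1) := Nat.mul_le_mul_left _ (by omega)
    _ = _ := mul_comm _ _

end LevelRun

end Level

end Rugby
-- All levels together: the robber's winning strategy
namespace Rugby

/-- The scales of a strategy with `D` levels, where level `d` has to deal with at most `N d`
cops. -/
structure IsLadder (D : ℕ) (N : ℕ → ℕ) (sc : ℕ → Scale) : Prop where
  cap_eq : ∀ d, (sc d).cap = N (d + 1)
  cap_lt : ∀ d < D, 2 * N d < 3 * (N (d + 1) + 1)
  last : N D = 0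
  delay_le : ∀ d < D, 3 * (sc d).delay + 10 ≤ (sc d).reach
  reach_le : ∀ d, d + 1 < D → 4 * (sc (d + 1)).reach + 3 * (sc d).delay + 15 ≤ (sc d).reach
  loss_le : ∀ d < D,
    4 * ∑ e ∈ Finset.Ioo d D, (N d / (N (e + 1) + 1) + 1) * (sc e).span ≤ (sc d).delay

section Strategy

variable {m : ℕ}

/-- The position of the robber and the states of all levels. -/
structure Stance (m : ℕ) where
  pos : Pos
  lev : ℕ → Level (Fin m)

/-- The cops that level `d` has to deal with. -/
def assigned (L : ℕ → Level (Fin m)) : ℕ → Finset (Fin m)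
  | 0 => Finset.univ
  | d + 1 => (L d).act

/-- One round of all levels. -/
def nextLevels (sc : ℕ → Scale) (g u : Fin m → ℤ) (L : ℕ → Level (Fin m)) : ℕ → Level (Fin m)
  | 0 => (L 0).next (sc 0) Finset.univ g u
  | d + 1 => (L (d + 1)).next (sc (d + 1)) (nextLevels sc g u L d).act g u

theorem nextLevels_eq (sc : ℕ → Scale) (g u : Fin m → ℤ) (L : ℕ → Level (Fin m)) (d : ℕ) :
    nextLevels sc g u L d = (L d).next (sc d) (assigned (nextLevels sc g u L) d) g u := by
  cases d <;> rfl

/-- The vertical velocity prescribed by the deepest escaping level among the first `D`, or `v` if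
there is none. -/
def heading (sc : ℕ → Scale) (L : ℕ → Level (Fin m)) (v : ℤ) : ℕ → ℤ
  | 0 => v
  | D + 1 => if (L D).age < (sc D).span then 2 * (L D).dir else heading sc L v D

/-- The vertical velocity that leads from height `y` to height `h`. -/
def homeward (h y : ℤ) : ℤ := max (-2) (min 2 (h - y))

/-- The course of the game if the robber follows the strategy with levels `sc 0, …, sc (D - 1)`
and height `h` as his home. -/
def run (D : ℕ) (sc : ℕ → Scale) (h : ℤ) (start : Pos) (c : ℕ → Config m) : ℕ → Stance m
  | 0 => ⟨start, fun d => Level.idle (sc d)⟩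
  | t + 1 =>
    let st := run D sc h start c t
    -- The move is fixed by the state before the latest cop turn; that turn only enters the update
    -- of the levels.
    let p : Pos := (st.pos.1 + 2, st.pos.2 + heading sc st.lev (homeward h st.pos.2) D)
    ⟨p, nextLevels sc (fun i => (c (t + 1) i).1 - p.1) (fun i => (c (t + 1) i).2 - p.2) st.lev⟩

theorem run_congr {D : ℕ} {sc : ℕ → Scale} {h : ℤ} {start : Pos} {c c' : ℕ → Config m} (t : ℕ)
    (hc : ∀ j ≤ t, c j = c' j) : run D sc h start c t = run D sc h start c' t := by
  induction t with
  | zero => rfl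
  | succ t ih =>
    have e := ih fun j hj => hc j (by omega)
    simp only [run, e, hc (t + 1) le_rfl]

theorem heading_of_escape {sc : ℕ → Scale} {L : ℕ → Level (Fin m)} {v : ℤ} {d D : ℕ} (hd : d < D)
    (h : (L d).age < (sc d).span) (hn : ∀ e ∈ Finset.Ioo d D, ¬ (L e).age < (sc e).span) :
    heading sc L v D = 2 * (L d).dir := by
  induction D with
  | zero => omega
  | succ D ih =>
    rw [heading]
    rcases (Nat.lt_succ_iff.1 hd).lt_or_eq with h1 | rfl
    · rw [if_neg (hn D (Finset.mem_Ioo.2 ⟨h1, by omega⟩))]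
      exact ih h1 fun e he => hn e (by rw [Finset.mem_Ioo] at *; omega)
    · rw [if_pos h]

theorem heading_of_forall_not {sc : ℕ → Scale} {L : ℕ → Level (Fin m)} {v : ℤ} {D : ℕ}
    (hn : ∀ e < D, ¬ (L e).age < (sc e).span) : heading sc L v D = v := by
  induction D with
  | zero => rfl
  | succ D ih =>
    rw [heading, if_neg (hn D (by omega))]
    exact ih fun e he => hn e (by omega)

theorem heading_mem {sc : ℕ → Scale} {L : ℕ → Level (Fin m)} {v : ℤ} {D : ℕ}
    (hdir : ∀ d < D, (L d).age < (sc d).span → (L d).dir = 1 ∨ (L d).dir = -1)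
    (hv : -2 ≤ v ∧ v ≤ 2) : -2 ≤ heading sc L v D ∧ heading sc L v D ≤ 2 := by
  induction D with
  | zero => exact hv
  | succ D ih =>
    rw [heading]
    split_ifs with h
    · have := hdir D (by omega) h
      omega
    · exact ih fun d hd => hdir d (by omega)

theorem homeward_mem (h y : ℤ) : -2 ≤ homeward h y ∧ homeward h y ≤ 2 := by
  unfold homeward
  omega

/-- A play of the robber's strategy against legal cop moves from an opening. -/
structure IsPlay (D : ℕ) (N : ℕ → ℕ) (sc : ℕ → Scale) (n : ℕ) (h : ℤ) (start : Pos)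
    (c : ℕ → Config m) : Prop where
  ladder : IsLadder D N sc
  card_le : m ≤ N 0
  reach_le : 2 * (sc 0).reach + 4 ≤ n
  loss_le : 8 * ∑ e ∈ Finset.range D, (N 0 / (N (e + 1) + 1) + 1) * (sc e).span + 4 ≤ n
  home : (n : ℤ) ≤ 2 * h ∧ 2 * h ≤ n + 1
  start_mem : InTunnel n start
  far : ∀ i, start.1 + 2 * (n : ℤ) ≤ (c 0 i).1
  step : ∀ t i, linfDist (c t i) (c (t + 1) i) ≤ 1

namespace IsPlay

variable {D : ℕ} {N : ℕ → ℕ} {sc : ℕ → Scale} {n : ℕ} {h : ℤ} {start : Pos} {c : ℕ → Config m}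

local notation "ρ" => run D sc h start c

theorem pos_fst (t : ℕ) : (ρ t).pos.1 = start.1 + 2 * t := by
  induction t with
  | zero => simp [run]
  | succ t ih =>
    simp only [run, ih]
    push_cast
    ring

theorem pos_snd (t : ℕ) : (ρ (t + 1)).pos.2
    = (ρ t).pos.2 + heading sc (ρ t).lev (homeward h (ρ t).pos.2) D := rfl

theorem cop_step (P : IsPlay D N sc n h start c) (t : ℕ) (i : Fin m) :
    ((c t i).1 - 1 ≤ (c (t + 1) i).1 ∧ (c (t + 1) i).1 ≤ (c t i).1 + 1) ∧
      ((c t i).2 - 1 ≤ (c (t + 1) i).2 ∧ (c (t + 1) i).2 ≤ (c t i).2 + 1) := by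
  have := P.step t i
  simp only [linfDist, max_le_iff, abs_le] at this
  omega

theorem cop_snd_le (P : IsPlay D N sc n h start c) {s t : ℕ} (hst : s ≤ t) (i : Fin m) :
    (c s i).2 - ((t : ℤ) - s) ≤ (c t i).2 ∧ (c t i).2 ≤ (c s i).2 + ((t : ℤ) - s) := by
  induction t, hst using Nat.le_induction with
  | base => simp
  | succ t _ ih =>
    have := P.cop_step t i
    push_cast
    omega

/-- All levels work. -/
theorem levelRun (P : IsPlay D N sc n h start c) (d : ℕ) (hd : d < D) :
    LevelRun (sc d) (N d)
      (if d = 0 then 2 * (n : ℤ) else (sc (d - 1)).reach - 3 * (sc (d - 1)).delay - 8)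
      (fun t => assigned (ρ t).lev d) (fun t i => (c t i).1 - (ρ t).pos.1)
      (fun t i => (c t i).2 - (ρ t).pos.2) (fun t => (ρ t).lev d) := by
  have hfall : ∀ t i, (c t i).1 - (ρ t).pos.1 - 3 ≤ (c (t + 1) i).1 - (ρ (t + 1)).pos.1 ∧
      (c (t + 1) i).1 - (ρ (t + 1)).pos.1 ≤ (c t i).1 - (ρ t).pos.1 - 1 := by
    intro t i
    have h1 := P.cop_step t i
    rw [pos_fst, pos_fst]
    push_cast
    omega
  -- Induction on the depth: `join_act` and `card_act` of one level are the hypotheses `join` and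
  -- `card` of the next.
  induction d with
  | zero =>
    refine ⟨rfl, fun t => nextLevels_eq _ _ _ _ 0, hfall, fun i _ => ?_, fun t i _ hn => ?_,
      fun t => ?_, ?_, P.ladder.delay_le 0 hd, ?_⟩
    · have := P.far i
      simp only [run, if_true]
      omega
    · exact absurd (Finset.mem_univ i) hn
    · simpa [assigned] using P.card_le
    · have := P.reach_le
      simp only [if_true]
      omega
    · rw [P.ladder.cap_eq]
      exact P.ladder.cap_lt 0 hd
  | succ d ih =>
    have R := ih (by omega)
    refine ⟨rfl, fun t => nextLevels_eq _ _ _ _ (d + 1), hfall, fun i hi => ?_,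
      fun t i hi hn => ?_, fun t => ?_, ?_, P.ladder.delay_le _ hd, ?_⟩
    · simp [assigned, run, Level.idle] at hi
    · simpa using R.join_act t i hi hn
    · rw [← P.ladder.cap_eq]
      exact R.card_act t
    · have := P.ladder.reach_le d hd
      simp only [Nat.add_eq_zero_iff, one_ne_zero, and_false, if_false, Nat.add_sub_cancel]
      omega
    · rw [P.ladder.cap_eq]
      exact P.ladder.cap_lt _ hd

theorem assigned_anti (P : IsPlay D N sc n h start c) (t : ℕ) {d e : ℕ} (hde : d ≤ e)
    (he : e ≤ D) : assigned (ρ t).lev e ⊆ assigned (ρ t).lev d := by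
  induction e, hde using Nat.le_induction with
  | base => exact Finset.Subset.refl _
  | succ e _ ih =>
    exact (((P.levelRun e (by omega)).act_subset t).trans (Finset.filter_subset _ _)).trans
      (ih (by omega))

theorem card_assigned (P : IsPlay D N sc n h start c) (t : ℕ) {d : ℕ} (hd : d ≤ D) :
    (assigned (ρ t).lev d).card ≤ N d := by
  cases d with
  | zero => simpa [assigned] using P.card_le
  | succ d =>
    rw [← P.ladder.cap_eq]
    exact (P.levelRun d hd).card_act t

theorem escape (P : IsPlay D N sc n h start c) (t : ℕ) {d : ℕ} (hd : d < D)
    (ha : ((ρ t).lev d).age < (sc d).span) :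
    ((ρ t).lev d).age ≤ t ∧ Escape (sc d) (assigned (ρ (t - ((ρ t).lev d).age)).lev d)
      (fun i => (c (t - ((ρ t).lev d).age) i).1 - (ρ (t - ((ρ t).lev d).age)).pos.1)
      (fun i => (c (t - ((ρ t).lev d).age) i).2 - (ρ (t - ((ρ t).lev d).age)).pos.2)
      ((ρ t).lev d) :=
  let ⟨h1, h2, _⟩ := ((P.levelRun d hd).inv t).escape ha
  ⟨h1, h2⟩

theorem heading_mem (P : IsPlay D N sc n h start c) (t : ℕ) :
    -2 ≤ heading sc (ρ t).lev (homeward h (ρ t).pos.2) D ∧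
      heading sc (ρ t).lev (homeward h (ρ t).pos.2) D ≤ 2 :=
  Rugby.heading_mem (fun _ hd ha => (P.escape t hd ha).2.dir_eq) (homeward_mem _ _)

/-- The total time that some levels spend escaping. -/
theorem card_exists_escaping_le (P : IsPlay D N sc n h start c) (a b k : ℕ) (E : Finset ℕ)
    [DecidablePred fun t => ∃ e ∈ E, ((ρ t).lev e).age < (sc e).span]
    (hE : ∀ e ∈ E, e < D) (B : Finset (Fin m)) (hB : B.card ≤ k)
    (hsub : ∀ t ∈ Finset.Ico a b, ∀ e ∈ E, assigned (ρ t).lev e ⊆ B) :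
    ({t ∈ Finset.Ico a b | ∃ e ∈ E, ((ρ t).lev e).age < (sc e).span}).card
      ≤ ∑ e ∈ E, (k / (N (e + 1) + 1) + 1) * (sc e).span := by
  have h1 : ({t ∈ Finset.Ico a b | ∃ e ∈ E, ((ρ t).lev e).age < (sc e).span}) ⊆
      E.biUnion fun e => {t ∈ Finset.Ico a b | ((ρ t).lev e).age < (sc e).span} := by
    intro t ht
    obtain ⟨ht, e, he, hl⟩ := Finset.mem_filter.1 ht
    exact Finset.mem_biUnion.2 ⟨e, he, Finset.mem_filter.2 ⟨ht, hl⟩⟩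
  refine (Finset.card_le_card h1).trans (Finset.card_biUnion_le.trans (Finset.sum_le_sum ?_))
  intro e he
  have h2 := (P.levelRun e (hE e he)).card_escaping_le a b B
    fun t ht => (Finset.filter_subset _ _).trans (hsub t ht e he)
  rw [P.ladder.cap_eq] at h2
  exact h2.trans (Nat.mul_le_mul_right _ (Nat.add_le_add_right (Nat.div_le_div_right hB) 1))

theorem card_filter_Ico_succ (p : ℕ → Prop) [DecidablePred p] {a b : ℕ} (hab : a ≤ b) :
    ({t ∈ Finset.Ico a (b + 1) | p t}).card
      = ({t ∈ Finset.Ico a b | p t}).card + if p b then 1 else 0 := by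
  rw [← Finset.insert_Ico_right_eq_Ico_add_one hab, Finset.filter_insert]
  split_ifs
  · rw [Finset.card_insert_of_notMem (by simp)]
  · rfl

/-- The robber has got away from the cops he flees from once the delay is over. -/
theorem two_le_of_flee (P : IsPlay D N sc n h start c) {t d : ℕ} (hd : d < D)
    (ha : ((ρ t).lev d).age < (sc d).span) (hdelay : (sc d).delay + 2 ≤ ((ρ t).lev d).age)
    {i : Fin m} (hi : i ∈ ((ρ t).lev d).flee) : 2 ≤ |(c t i).2 - (ρ t).pos.2| := by
  classical
  obtain ⟨hle, E⟩ := P.escape t hd ha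
  have R := P.levelRun d hd
  set s := t - ((ρ t).lev d).age with hs
  set q : ℕ → Prop := fun t' => ∃ e ∈ Finset.Ioo d D, ((ρ t').lev e).age < (sc e).span with hq
  have hcount : ({t' ∈ Finset.Ico s t | q t'}).card
      ≤ ∑ e ∈ Finset.Ioo d D, (N d / (N (e + 1) + 1) + 1) * (sc e).span := by
    refine P.card_exists_escaping_le s t (N d) _ (fun e he => (Finset.mem_Ioo.1 he).2)
      (assigned (ρ s).lev d) (P.card_assigned s hd.le) ?_
    intro t' ht' e he j hj
    rw [Finset.mem_Ico] at ht'
    rw [Finset.mem_Ioo] at he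
    have hj' := R.act_subset t' (P.assigned_anti t' (show d + 1 ≤ e from he.1) he.2.le hj)
    exact R.mem_of_near ht'.1 (by omega) hj'
  have hloss := P.ladder.loss_le d hd
  -- A round taken over by a deeper level costs at most 4: velocity `-2` in place of `2` along
  -- `dir`.
  have hmove : ∀ k, s + k ≤ t → 2 * (k : ℤ) - 4 * ({t' ∈ Finset.Ico s (s + k) | q t'}).card
      ≤ ((ρ t).lev d).dir * ((ρ (s + k)).pos.2 - (ρ s).pos.2) := by
    intro k
    induction k with
    | zero => simp
    | succ k ih =>
      intro hk
      have h1 := ih (by omega)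
      have h2 := R.age_sub ha (t - (s + k)) (by omega)
      rw [show t - (t - (s + k)) = s + k by omega] at h2
      have h3 := P.heading_mem (s + k)
      have h4 := E.dir_eq
      rw [← add_assoc, card_filter_Ico_succ q (by omega), pos_snd]
      split_ifs with hcase
      · rcases h4 with h4 | h4 <;> rw [h4] at h1 ⊢ <;> push_cast <;> omega
      · have h5 := heading_of_escape (v := homeward h (ρ (s + k)).pos.2) hd
          (show ((ρ (s + k)).lev d).age < (sc d).span by omega)
          fun e he hh => hcase ⟨e, he, hh⟩
        rw [h2.2] at h5
        rw [h5]
        rcases h4 with h4 | h4 <;> rw [h4] at h1 ⊢ <;> push_cast <;> omega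
  -- The robber has moved at least `2 * (t - s) - delay` and a cop at most `t - s`, so the lead is
  -- at least `t - s - delay ≥ 2`.
  have h1 := hmove (t - s) (by omega)
  rw [show s + (t - s) = t by omega] at h1
  have h2 := E.away i hi
  have h3 := P.cop_snd_le (show s ≤ t by omega) i
  rw [le_abs]
  have h4 : ((t - s : ℕ) : ℤ) = (t : ℤ) - s := by omega
  rcases E.dir_eq with h5 | h5 <;> rw [h5] at h1 h2 <;> omega

/-- No cop gets the chance to catch the robber. -/
theorem not_close (P : IsPlay D N sc n h start c) (t : ℕ) (i : Fin m) :
    2 ≤ (c t i).1 - (ρ t).pos.1 ∨ (c t i).1 - (ρ t).pos.1 ≤ -2 ∨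
      2 ≤ |(c t i).2 - (ρ t).pos.2| := by
  have hlast : i ∉ assigned (ρ t).lev D := by
    have h1 := P.card_assigned t le_rfl
    rw [P.ladder.last, Nat.le_zero, Finset.card_eq_zero] at h1
    simp [h1]
  -- Level `D` has no cops, so every cop is dropped by some level, and that level answers for it.
  have key : ∀ k ≤ D, i ∉ assigned (ρ t).lev k →
      ∃ d < k, i ∈ assigned (ρ t).lev d ∧ i ∉ assigned (ρ t).lev (d + 1) := by
    intro k
    induction k with
    | zero => exact fun _ hn => absurd (Finset.mem_univ i) hn
    | succ k ih =>
      intro hk hn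
      by_cases hik : i ∈ assigned (ρ t).lev k
      · exact ⟨k, by omega, hik, hn⟩
      · obtain ⟨d, hd, h1⟩ := ih (by omega) hik
        exact ⟨d, by omega, h1⟩
  obtain ⟨d, hd, h1, h2⟩ := key D le_rfl hlast
  rcases (P.levelRun d hd).harmless_or_flee h1 h2 with h3 | h3 | ⟨h3, h4, h5⟩
  · exact Or.inl h3
  · exact Or.inr (Or.inl h3)
  · exact Or.inr (Or.inr (P.two_le_of_flee hd h3 h4 h5))

/-- There is no escape before the robber has had the time to go home. -/
theorem le_of_escape (P : IsPlay D N sc n h start c) {t d : ℕ} (hd : d < D)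
    (ha : ((ρ t).lev d).age < (sc d).span) : (n : ℤ) ≤ 2 * t := by
  obtain ⟨hle, E⟩ := P.escape t hd ha
  set s := t - ((ρ t).lev d).age with hs
  obtain ⟨i, hi⟩ := Finset.card_pos.1 (Nat.zero_lt_of_lt E.card_near)
  have hi' : (c s i).1 - (ρ s).pos.1 ≤ (sc 0).reach := by
    rcases Nat.eq_zero_or_pos d with rfl | hpos
    · exact (Scale.mem_near.1 hi).2.2
    · exact (Scale.mem_near.1 ((P.levelRun 0 (by omega)).act_subset s
        (P.assigned_anti s (show 1 ≤ d from hpos) hd.le (Scale.mem_near.1 hi).1))).2.2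
  -- From gap at least `2 * n`, falling by at most 3 per round, to at most `n / 2 - 2` takes more
  -- than `n / 2` rounds.
  have h1 := (P.levelRun d hd).gap_le (Nat.zero_le s) i
  have h2 := P.far i
  have h3 := P.reach_le
  simp only [run] at h1
  push_cast at h1
  omega

theorem inTunnel (P : IsPlay D N sc n h start c) (t : ℕ) : InTunnel n (ρ t).pos := by
  classical
  set q : ℕ → Prop := fun t' => ∃ e ∈ Finset.range D, ((ρ t').lev e).age < (sc e).span with hq
  have hcount := P.card_exists_escaping_le 0 t (N 0) (Finset.range D)
    (fun e he => Finset.mem_range.1 he) Finset.univ (by simpa using P.card_le)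
    fun _ _ _ _ => Finset.subset_univ _
  have hloss := P.loss_le
  have hhome := P.home
  have hnot : ∀ t, ¬ q t →
      heading sc (ρ t).lev (homeward h (ρ t).pos.2) D = homeward h (ρ t).pos.2 := fun t ht =>
    heading_of_forall_not fun e he hh => ht ⟨e, Finset.mem_range.2 he, hh⟩
  -- Without escapes the distance from home drops by 2 per round until it is 0. An escaping round
  -- costs 4: up to 2 moved away, and 2 because the first term may drop meanwhile.
  have hdrift : ∀ t : ℕ, |(ρ t).pos.2 - h| ≤
      max ((n : ℤ) - 2 * t) 0 + 4 * ({t' ∈ Finset.Ico 0 t | q t'}).card := by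
    intro t
    induction t with
    | zero =>
      have := P.start_mem
      simp only [InTunnel] at this
      simp only [run, abs_le]
      simp
      omega
    | succ t ih =>
      have h1 := P.heading_mem t
      rw [card_filter_Ico_succ q (by omega), pos_snd]
      rw [abs_le] at ih ⊢
      split_ifs with hcase
      · push_cast
        omega
      · rw [hnot t hcase]
        simp only [homeward]
        push_cast
        omega
  -- Before any escape he only walks from a vertex of the tunnel towards `h`. Afterwards `n ≤ 2 *
  -- t`, so the first term of the drift bound is gone.
  by_cases hall : ∀ t' < t, ¬ q t'
  · have : ∀ k ≤ t, InTunnel n (ρ k).pos := by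
      intro k
      induction k with
      | zero => exact fun _ => P.start_mem
      | succ k ih =>
        intro hk
        have h1 := ih (by omega)
        simp only [InTunnel] at h1 ⊢
        rw [pos_snd, hnot k (hall k (by omega))]
        simp only [homeward]
        omega
    exact this t le_rfl
  · push Not at hall
    obtain ⟨t', ht', e, he, hh⟩ := hall
    have h1 := P.le_of_escape (Finset.mem_range.1 he) hh
    have h2 := hdrift t
    rw [abs_le] at h2
    simp only [InTunnel]
    have h3 : ({t' ∈ Finset.Ico 0 t | q t'}).card
      ≤ ∑ e ∈ Finset.range D, (N 0 / (N (e + 1) + 1) + 1) * (sc e).span := hcount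
    omega

theorem robberWins (P : IsPlay D N sc n h start c) :
    IsRobberPlay n start (fun t => (ρ t).pos) ∧ RobberWinsPlay c (fun t => (ρ t).pos) := by
  refine ⟨⟨rfl, P.inTunnel, fun t => ?_⟩, ⟨fun t i hi => ?_, fun t i hi => ?_, fun k hk => ?_⟩⟩
  · have h1 := P.heading_mem t
    simp only [linfDist, max_le_iff, abs_le, pos_fst, pos_snd]
    push_cast
    omega
  · have h1 := P.not_close t i
    rw [hi] at h1
    simp at h1
  · have h1 := P.not_close t i
    have h2 := P.cop_step t i
    rw [le_abs] at h1
    rw [hi] at h2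
    omega
  · refine ⟨(k - start.1).toNat + k.toNat, ?_⟩
    rw [pos_fst]
    push_cast
    omega

end IsPlay

theorem robberHasWinningStrategy_of_isLadder {D : ℕ} {N : ℕ → ℕ} {sc : ℕ → Scale} {n : ℕ}
    (hl : IsLadder D N sc) (hm : m ≤ N 0) (hreach : 2 * (sc 0).reach + 4 ≤ n)
    (hloss : 8 * ∑ e ∈ Finset.range D, (N 0 / (N (e + 1) + 1) + 1) * (sc e).span + 4 ≤ n)
    {init : Config m} {start : Pos} (ho : IsOpening n init start) :
    RobberHasWinningStrategy n init start := by
  -- The list seen at his turn `t + 1` has length `t + 2`; the default `init` is never read at the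
  -- times that matter.
  refine ⟨fun l => (run D sc (((n + 1) / 2 : ℕ) : ℤ) start (fun j => l.getD j init)
    (l.length - 1)).pos, fun c hc => ?_⟩
  have P : IsPlay D N sc n (((n + 1) / 2 : ℕ) : ℤ) start c :=
    ⟨hl, hm, hreach, hloss, by omega, ho.robber_in, by rw [hc.zero]; exact ho.far, hc.step⟩
  have hpath : robberPath (fun l => (run D sc (((n + 1) / 2 : ℕ) : ℤ) start
      (fun j => l.getD j init) (l.length - 1)).pos) start c =
      fun t => (run D sc (((n + 1) / 2 : ℕ) : ℤ) start c t).pos := by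
    funext t
    cases t with
    | zero => rfl
    | succ t =>
      rw [robberPath]
      simp only [List.length_map, List.length_range]
      refine congrArg Stance.pos (run_congr (t + 1) fun j hj => ?_)
      have : j < ((List.range (t + 2)).map c).length := by simp; omega
      rw [List.getD_eq_getElem _ _ this]
      simp
  rw [hpath]
  exact P.robberWins

end Strategy

end Rugby
-- Choice of the scales and the exponent
namespace Rugby

/-- The number of cops that a strategy with `k` levels can deal with. -/
def capacity : ℕ → ℕ
  | 0 => 0
  -- The largest `N` with `2 * N < 3 * (capacity k + 1)`.
  | k + 1 => (3 * capacity k + 2) / 2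

theorem capacity_add_one_le (k : ℕ) : capacity (k + 1) + 1 ≤ 2 * (capacity k + 1) := by
  rw [capacity]
  omega

theorem capacity_div_le (k j : ℕ) : capacity (k + j) / (capacity k + 1) ≤ 2 ^ j := by
  have h : capacity (k + j) + 1 ≤ 2 ^ j * (capacity k + 1) := by
    induction j with
    | zero => simp
    | succ j ih =>
      have := capacity_add_one_le (k + j)
      rw [← add_assoc, pow_succ]
      linarith
  exact Nat.div_le_of_le_mul (by rw [mul_comm]; omega)

theorem pow_le_capacity_add_one (k : ℕ) : (3 / 2 : ℝ) ^ k ≤ capacity k + 1 := by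
  induction k with
  | zero => simp [capacity]
  | succ k ih =>
    have h : 3 * (capacity k + 1) ≤ 2 * (capacity (k + 1) + 1) := by
      rw [capacity]
      omega
    have h' : (3 : ℝ) * (capacity k + 1) ≤ 2 * (capacity (k + 1) + 1) := by exact_mod_cast h
    rw [pow_succ]
    linarith

/-- The ratio of the lengths of consecutive scales. -/
abbrev ratio : ℕ := 490000

/-- The number of escapes at most doubles per level while their length falls by `ratio`, so the
first term dominates. The summand `3 * 2 ^ r` is there to make the induction close. -/
theorem sum_two_pow_mul_ratio_pow_le (r : ℕ) :
    ∑ i ∈ Finset.range r, 2 ^ (i + 1) * ratio ^ (r - i) + 3 * 2 ^ r ≤ 3 * ratio ^ r := by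
  induction r with
  | zero => simp
  | succ r ih =>
    have h : ∑ i ∈ Finset.range r, 2 ^ (i + 1) * ratio ^ (r + 1 - i)
        = ratio * ∑ i ∈ Finset.range r, 2 ^ (i + 1) * ratio ^ (r - i) := by
      rw [Finset.mul_sum]
      refine Finset.sum_congr rfl fun i hi => ?_
      rw [Nat.sub_add_comm (Finset.mem_range.1 hi).le, pow_succ]
      ring
    rw [Finset.sum_range_succ, h, Nat.add_sub_cancel_left, pow_one, pow_succ 2 r,
      pow_succ ratio r]
    simp only [ratio] at *
    omega

theorem loss_term_le {k j l : ℕ} :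
    (capacity (k + j) / (capacity k + 1) + 1) * (ratio ^ l + 2) ≤ 6 * 2 ^ j * ratio ^ l := by
  have h1 := capacity_div_le k j
  have h2 : 1 ≤ 2 ^ j := Nat.one_le_two_pow
  have h3 : 1 ≤ ratio ^ l := Nat.one_le_pow _ _ (by norm_num)
  calc (capacity (k + j) / (capacity k + 1) + 1) * (ratio ^ l + 2)
      ≤ (2 * 2 ^ j) * (3 * ratio ^ l) := Nat.mul_le_mul (by omega) (by omega)
    _ = 6 * 2 ^ j * ratio ^ l := by ring

/-- The scales of the strategy with `K` levels. -/
def ladder (K d : ℕ) : Scale :=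
  -- `122500 = ratio / 4`: for `d < K` the delay is a quarter of the reach.
  ⟨ratio ^ (K - d), 122500 * ratio ^ (K - d - 1), capacity (K - d - 1)⟩

theorem isLadder (K : ℕ) : IsLadder K (fun d => capacity (K - d)) (ladder K) := by
  refine ⟨fun d => ?_, fun d hd => ?_, ?_, fun d hd => ?_, fun d hd => ?_, fun d hd => ?_⟩
  · simp only [ladder, Nat.sub_sub]
  · obtain ⟨r, rfl⟩ := Nat.exists_eq_add_of_lt hd
    have h1 : d + r + 1 - d = r + 1 := by omega
    have h2 : d + r + 1 - (d + 1) = r := by omega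
    simp only [h1, h2, capacity]
    omega
  · simp [capacity]
  · obtain ⟨r, rfl⟩ := Nat.exists_eq_add_of_lt hd
    have h1 : d + r + 1 - d = r + 1 := by omega
    have h3 : 1 ≤ ratio ^ r := Nat.one_le_pow _ _ (by norm_num)
    simp only [ladder, h1, Nat.add_sub_cancel, pow_succ]
    simp only [ratio] at *
    omega
  · obtain ⟨r, rfl⟩ := Nat.exists_eq_add_of_lt hd
    have h1 : d + 1 + r + 1 - d = r + 2 := by omega
    have h2 : d + 1 + r + 1 - (d + 1) = r + 1 := by omega
    have h3 : 1 ≤ ratio ^ (r + 1) := Nat.one_le_pow _ _ (by norm_num)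
    have h4 : r + 2 - 1 = r + 1 := by omega
    simp only [ladder, h1, h2, h4, pow_succ ratio (r + 1)]
    simp only [ratio] at *
    omega
  · obtain ⟨r, rfl⟩ := Nat.exists_eq_add_of_lt hd
    have h1 : d + r + 1 - d = r + 1 := by omega
    have hI : Finset.Ioo d (d + r + 1) = Finset.Ico (d + 1) (d + r + 1) := by
      ext x
      simp only [Finset.mem_Ioo, Finset.mem_Ico]
      omega
    have h2 : d + r + 1 - (d + 1) = r := by omega
    rw [hI, Finset.sum_Ico_eq_sum_range, h2]
    have hsum : ∑ i ∈ Finset.range r, (capacity (d + r + 1 - d) /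
        (capacity (d + r + 1 - (d + 1 + i + 1)) + 1) + 1) * (ladder (d + r + 1) (d + 1 + i)).span
        ≤ ∑ i ∈ Finset.range r, 12 * (2 ^ (i + 1) * ratio ^ (r - i)) := by
      refine Finset.sum_le_sum fun i hi => ?_
      rw [Finset.mem_range] at hi
      have e1 : d + r + 1 - d = (r - 1 - i) + (i + 2) := by omega
      have e2 : d + r + 1 - (d + 1 + i + 1) = r - 1 - i := by omega
      have e3 : d + r + 1 - (d + 1 + i) = r - i := by omega
      simp only [Scale.span, ladder]
      rw [e1, e2, e3]
      refine loss_term_le.trans (le_of_eq ?_)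
      ring
    rw [← Finset.mul_sum] at hsum
    -- The loss is at most `4 * 12 * 3 = 144` times `ratio ^ r`, far below the delay `122500 * ratio
    -- ^ r`.
    have hgeom := sum_two_pow_mul_ratio_pow_le r
    simp only [ladder, h1, Nat.add_sub_cancel] at hsum ⊢
    omega

theorem total_loss_le (K : ℕ) : ∑ e ∈ Finset.range K,
    (capacity (K - 0) / (capacity (K - (e + 1)) + 1) + 1) * (ladder K e).span
      ≤ 18 * ratio ^ K := by
  have hsum : ∑ e ∈ Finset.range K,
      (capacity (K - 0) / (capacity (K - (e + 1)) + 1) + 1) * (ladder K e).span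
      ≤ ∑ e ∈ Finset.range K, 6 * (2 ^ (e + 1) * ratio ^ (K - e)) := by
    refine Finset.sum_le_sum fun e he => ?_
    rw [Finset.mem_range] at he
    have e1 : K - 0 = (K - (e + 1)) + (e + 1) := by omega
    nth_rw 1 [e1]
    simp only [Scale.span, ladder]
    refine loss_term_le.trans (le_of_eq ?_)
    ring
  rw [← Finset.mul_sum] at hsum
  have hgeom := sum_two_pow_mul_ratio_pow_le K
  omega

/-- The constant is `148 = 8 * 18 + 4`, from the total loss `18 * ratio ^ K` and the room the drift
needs. -/
theorem capacity_lt_of_copsCanPrevent {n m K : ℕ} (hK : 148 * ratio ^ K ≤ n)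
    (h : CopsCanPrevent n m) : capacity K < m := by
  by_contra hm
  obtain ⟨init, start, ho, hn⟩ := h
  have h1 : 1 ≤ ratio ^ K := Nat.one_le_pow _ _ (by norm_num)
  have h2 := total_loss_le K
  refine hn (robberHasWinningStrategy_of_isLadder (isLadder K) (by simpa using hm) ?_ ?_ ho)
  · simp only [ladder, Nat.sub_zero]
    omega
  · omega

/-- The exponent of the lower bound. -/
noncomputable def exponent : ℝ := Real.log (3 / 2) / (2 * Real.log 700)

theorem exponent_pos : 0 < exponent :=
  div_pos (Real.log_pos (by norm_num)) (mul_pos two_pos (Real.log_pos (by norm_num)))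

theorem le_exponent : (0.03 : ℝ) ≤ exponent := by
  have h700 : 0 < Real.log 700 := Real.log_pos (by norm_num)
  rw [exponent, le_div_iff₀ (by positivity)]
  -- The claim `0.06 * log 700 ≤ log (3/2)`, multiplied by 50.
  have h : Real.log ((700 : ℝ) ^ 3) ≤ Real.log ((3 / 2 : ℝ) ^ 50) :=
    Real.log_le_log (by norm_num) (by norm_num)
  rw [Real.log_pow, Real.log_pow] at h
  push_cast at h
  linarith

theorem ratio_rpow_exponent : (ratio : ℝ) ^ exponent = 3 / 2 := by
  have h700 : Real.log 700 ≠ 0 := (Real.log_pos (by norm_num)).ne'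
  have h : Real.log (ratio : ℝ) = 2 * Real.log 700 := by
    rw [show ((ratio : ℕ) : ℝ) = 700 ^ 2 by norm_num [ratio], Real.log_pow]
    norm_num
  rw [Real.rpow_def_of_pos (by norm_num [ratio]), h, exponent,
    mul_div_cancel₀ _ (by simpa using h700), Real.exp_log (by norm_num)]

theorem mul_rpow_exponent_le {n m : ℕ} (hn : 148 ≤ n) (h : CopsCanPrevent n m) :
    ((148 * ratio : ℝ) ^ exponent)⁻¹ * (n : ℝ) ^ exponent ≤ m := by
  -- The largest number of levels for which the tunnel is wide enough; rounding loses at most the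
  -- factor `148 * ratio` in `n`, absorbed by the constant.
  set K := Nat.log ratio (n / 148) with hKdef
  have hK : ratio ^ K ≤ n / 148 := Nat.pow_log_le_self _ (by omega)
  have hK' : n / 148 < ratio ^ (K + 1) := Nat.lt_pow_succ_log_self (by norm_num) _
  have h1 := capacity_lt_of_copsCanPrevent (K := K) (by omega) h
  have h2 : (n : ℝ) ≤ (148 * ratio) * ratio ^ K := by
    have : n ≤ 148 * ratio * ratio ^ K := by
      rw [pow_succ] at hK'
      have : n < 148 * (ratio ^ K * ratio) := by omega
      linarith
    exact_mod_cast this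
  have h3 : (n : ℝ) ^ exponent ≤ (148 * ratio : ℝ) ^ exponent * (3 / 2) ^ K := by
    calc (n : ℝ) ^ exponent ≤ ((148 * ratio) * ratio ^ K : ℝ) ^ exponent :=
          Real.rpow_le_rpow (Nat.cast_nonneg _) h2 exponent_pos.le
      _ = (148 * ratio : ℝ) ^ exponent * (3 / 2) ^ K := by
          rw [Real.mul_rpow (by positivity) (by positivity), ← Real.rpow_natCast, ← Real.rpow_mul
            (by positivity), mul_comm (K : ℝ), Real.rpow_mul (by positivity), ratio_rpow_exponent,
            Real.rpow_natCast]
  have h4 := pow_le_capacity_add_one K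
  have h5 : (capacity K : ℝ) + 1 ≤ m := by exact_mod_cast h1
  rw [inv_mul_le_iff₀ (by positivity)]
  exact h3.trans (mul_le_mul_of_nonneg_left (h4.trans h5) (by positivity))

end Rugby

theorem theorem3p3 :
    (∃ c : ℝ, 0 < c ∧ ∃ N : ℕ, ∀ n : ℕ, N ≤ n → ∀ m : ℕ,
      Rugby.CopsCanPrevent n m → c * (n : ℝ) ^ (0.03 : ℝ) ≤ (m : ℝ)) ∧
    (∃ c : ℝ, 0 < c ∧ ∃ N : ℕ, ∀ n : ℕ, N ≤ n → ∀ m : ℕ,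
      Rugby.CopsCanPrevent n m →
        c * (n : ℝ) ^ (Real.log (3 / 2) / (2 * Real.log 700)) ≤ (m : ℝ)) := by
  have hc : 0 < ((148 * Rugby.ratio : ℝ) ^ Rugby.exponent)⁻¹ := by positivity
  refine ⟨⟨_, hc, 148, fun n hn m h => ?_⟩, ⟨_, hc, 148, fun n hn m h => ?_⟩⟩
  · refine le_trans (mul_le_mul_of_nonneg_left ?_ hc.le) (Rugby.mul_rpow_exponent_le hn h)
    exact Real.rpow_le_rpow_of_exponent_le (by exact_mod_cast (by omega : 1 ≤ n)) Rugby.le_exponent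
  · exact Rugby.mul_rpow_exponent_le hn h
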